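/- Let $d\ge 1$ and let $\mathscr{L}^d$ denote Lebesgue measure on $\mathbb{R}^d$. Let $BV(\mathbb{R}^d)$ be the space of real-valued functions $f\in L^1(\mathbb{R}^d)$ whose distributional gradient is a finite $\mathbb{R}^d$-valued Borel measure $Df$, i.e. $\int \varphi\, dDf=-\int f\,\nabla\varphi\,dx$ for all $\varphi\in C_c^\infty(\mathbb{R}^d)$. Let $D^sf$ denote the singular part of $Df$ with respect to $\mathscr{L}^d$ and $|D^sf|$ its total variation measure. For $f\in L^1_{\mathrm{loc}}(\mathbb{R}^d)$ and $x\in\mathbb{R}^d$ set \[ \mathsf{A}f(x):=\sup_{r>0}\frac1r\cdot\frac{1}{\mathscr{L}^d(B(x,r))}\int_{B(x,r)}|f(y)-(f)_{x,r}|\,dy\in[0,+\infty], \qquad (f)_{x,r}:=\frac{1}{\mathscr{L}^d(B(x,r))}\int_{B(x,r)}f(y)\,dy, \] where $B(x,r)$ is the ball of centre $x$ and radius $r$. Theorem. There is a constant $C>0$ depending only on $d$ such that, for every $f\in BV(\mathbb{R}^d)$, \[ \liminf_{\lambda\to+\infty}\lambda\,\mathscr{L}^d\big(\{x\in\mathbb{R}^d:\mathsf{A}f(x)>\lambda\}\big)\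 \ge\ C\,|D^sf|(\mathbb{R}^d). \] In particular, a function $f\in BV(\mathbb{R}^d)$ belongs to $W^{1,1}(\mathbb{R}^d)$ (that is, it has a weak gradient in $L^1(\mathbb{R}^d;\mathbb{R}^d)$) if and only if \[ \liminf_{\lambda\to+\infty}\lambda\,\mathscr{L}^d\big(\{x\in\mathbb{R}^d:\mathsf{A}f(x)>\lambda\}\big)=0. \] -/

import Mathlib

open MeasureTheory Set Filter
open scoped ENNReal NNReal ContDiff Gradient

namespace BVSobolev

noncomputable section

/-- The Euclidean space `ℝ^d`. -/
abbrev E (d : ℕ) : Type := EuclideanSpace ℝ (Fin d)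

/-- The finite `ℝ^d`-valued measure `μ` is the distributional gradient of `f`:
`∫ φ dμ = - ∫ f ∇φ dx` for every test function `φ ∈ C_c^∞(ℝ^d)`. -/
def IsGradientMeasure {d : ℕ} (f : E d → ℝ) (μ : VectorMeasure (E d) (E d)) : Prop :=
  ∀ φ : E d → ℝ, ContDiff ℝ ∞ φ → HasCompactSupport φ →
    ∫ᵛ x, φ x ∂•μ = - ∫ x, f x • ∇ φ x

/-- The integrable vector field `g` is the weak gradient of `f`. -/
def IsWeakGradient {d : ℕ} (f : E d → ℝ) (g : E d → E d) : Prop :=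
  ∀ φ : E d → ℝ, ContDiff ℝ ∞ φ → HasCompactSupport φ →
    ∫ x, φ x • g x = - ∫ x, f x • ∇ φ x

/-- `f ∈ BV(ℝ^d)`: `f` is integrable and its distributional gradient is a finite
`ℝ^d`-valued measure. -/
def MemBV {d : ℕ} (f : E d → ℝ) : Prop :=
  MemLp f 1 volume ∧ ∃ μ : VectorMeasure (E d) (E d), IsGradientMeasure f μ

/-- `f ∈ W^{1,1}(ℝ^d)`: `f` is integrable and has an integrable weak gradient. -/
def MemW11 {d : ℕ} (f : E d → ℝ) : Prop :=
  MemLp f 1 volume ∧ ∃ g : E d → E d, MemLp g 1 volume ∧ IsWeakGradient f g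

/-- The total variation of an `ℝ^d`-valued measure is finite. -/
instance isFiniteMeasure_variation {d : ℕ} (μ : VectorMeasure (E d) (E d)) :
    IsFiniteMeasure μ.variation := by
  let c : Fin d → SignedMeasure (E d) := fun i =>
    μ.mapRange (EuclideanSpace.proj i : E d →L[ℝ] ℝ).toLinearMap.toAddMonoidHom
      (EuclideanSpace.proj i : E d →L[ℝ] ℝ).continuous
  have hfin : ∀ i, IsFiniteMeasure (c i).variation := fun i => by
    rw [← SignedMeasure.totalVariation_eq_variation, SignedMeasure.totalVariation]
    infer_instance
  have hsum : IsFiniteMeasure (∑ i, (c i).variation) :=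
    ⟨by rw [Measure.finsetSum_apply]; exact ENNReal.sum_lt_top.2 fun i _ => measure_lt_top _ _⟩
  refine isFiniteMeasure_of_le (∑ i, (c i).variation)
    (VectorMeasure.variation_le_of_forall_enorm_le fun s _ => ?_)
  have h1 : ‖μ s‖ₑ ≤ ∑ i, ‖c i s‖ₑ := by
    have h2 : μ s = ∑ i, EuclideanSpace.single i (μ s i) := by
      ext j
      simp
    calc ‖μ s‖ₑ = ‖∑ i, EuclideanSpace.single i (μ s i)‖ₑ := by rw [← h2]
      _ ≤ ∑ i, ‖EuclideanSpace.single i (μ s i)‖ₑ := enorm_sum_le _ _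
      _ = ∑ i, ‖c i s‖ₑ := by
        refine Finset.sum_congr rfl fun i _ => ?_
        rw [← ofReal_norm, ← ofReal_norm, PiLp.norm_single]
        rfl
  refine h1.trans ?_
  rw [Measure.finsetSum_apply]
  exact Finset.sum_le_sum fun i _ => VectorMeasure.enorm_measure_le_variation _ _

/-- The singular part `μ^s` of an `ℝ^d`-valued measure `μ` with respect to Lebesgue measure: the
restriction of `μ` to a Lebesgue null set that carries the singular part of `|μ|`.
The theorem `singularPart_spec` below says that `μ = (μ - μ^s) + μ^s` is the
Lebesgue decomposition of `μ`. -/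
def singularPart {d : ℕ} (μ : VectorMeasure (E d) (E d)) : VectorMeasure (E d) (E d) :=
  μ.restrict (Measure.mutuallySingular_singularPart μ.variation volume).nullSetᶜ

theorem singularPart_spec {d : ℕ} (μ : VectorMeasure (E d) (E d)) :
    (μ - singularPart μ).AbsolutelyContinuous
        (volume : Measure (E d)).toENNRealVectorMeasure ∧
      (singularPart μ).MutuallySingular (volume : Measure (E d)).toENNRealVectorMeasure := by
  set h := Measure.mutuallySingular_singularPart μ.variation (volume : Measure (E d))
  have hN := h.measurableSet_nullSet
  constructor
  · refine VectorMeasure.AbsolutelyContinuous.mk fun s hs hs0 => ?_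
    rw [Measure.toENNRealVectorMeasure_apply_measurable hs] at hs0
    have h1 : μ.variation (s ∩ h.nullSet) = 0 := by
      have h4 := congrArg (fun m : Measure (E d) => m (s ∩ h.nullSet))
        (Measure.haveLebesgueDecomposition_add μ.variation (volume : Measure (E d)))
      simp only [Measure.add_apply] at h4
      rw [h4, measure_mono_null inter_subset_right h.measure_nullSet, zero_add]
      exact withDensity_absolutelyContinuous _ _ (measure_mono_null inter_subset_left hs0)
    have h2 : μ (s ∩ h.nullSet) = 0 := by
      have := μ.enorm_measure_le_variation (s ∩ h.nullSet)
      rw [h1] at this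
      simpa using this
    have h3 : μ s = μ (s ∩ h.nullSet) + μ (s ∩ h.nullSetᶜ) := by
      rw [← VectorMeasure.of_union (disjoint_compl_right.mono inter_subset_right inter_subset_right)
        (hs.inter hN) (hs.inter hN.compl), inter_union_compl]
    rw [sub_apply, singularPart, VectorMeasure.restrict_apply _ hN.compl hs, h3, h2]
    simp
  · refine VectorMeasure.MutuallySingular.mk h.nullSet hN (fun t ht htm => ?_) (fun t ht htm => ?_)
    · rw [singularPart, VectorMeasure.restrict_apply _ hN.compl htm,
        (disjoint_compl_right.mono_left ht).inter_eq, VectorMeasure.empty]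
    · rw [Measure.toENNRealVectorMeasure_apply_measurable htm]
      exact measure_mono_null ht h.measure_compl_nullSet

/-- The maximal function `A f(x) = sup_{r > 0} r⁻¹ ⨍_{B(x,r)} |f - (f)_{x,r}|`, with values in
`[0,∞]`, where `(f)_{x,r} = ⨍_{B(x,r)} f`. -/
def maxA {d : ℕ} (f : E d → ℝ) (x : E d) : ℝ≥0∞ :=
  ⨆ (r : ℝ) (_ : 0 < r), (ENNReal.ofReal r)⁻¹ *
    ⨍⁻ y in Metric.ball x r, ‖f y - ⨍ z in Metric.ball x r, f z ∂volume‖ₑ ∂volume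

/-- `liminf_{t → ∞} t · L^d({x : A f(x) > t})`, with values in `[0,∞]`. -/
def liminfA {d : ℕ} (f : E d → ℝ) : ℝ≥0∞ :=
  liminf (fun t : ℝ => ENNReal.ofReal t * volume {x : E d | ENNReal.ofReal t < maxA f x}) atTop

end

end BVSobolev

/-! Lower bound: fix a coordinate direction, let `m` and `n` be the positive and negative parts of
the corresponding component of the gradient, and let `m'` be the restriction of `m` to a Lebesgue
null set carrying the singular part. Near `m'`-almost every point, both `n` and Lebesgue measure are
negligible compared with `m'`. Given a level t, take around such a point a ball of almost maximal
radius r on which `m'` has density at least a, a suitable multiple of t (`exists_radius_density`).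
Testing the derivative with a bump function bounds `m (closedBall x r)` by the `n`-mass of the
doubled ball plus a multiple of |B(x,r)| A f(y), for every y in the ball
(`measure_closedBall_le_maxA`). Almost maximality bounds `m'` on the doubled ball, so the `n` term
is absorbed and the whole ball lies in {A f > t}. It also bounds `m'` on the 5-fold ball, so
Vitali's lemma bounds the mass of `m'` by a multiple of t |{A f > t}| (`measure_univ_le_liminfA`).
Summing over coordinates and signs gives the theorem.

Characterisation: if the liminf vanishes, the gradient is absolutely continuous, and Radon–Nikodym
gives an integrable weak gradient. Conversely, for a Sobolev function with gradient g, Poincaré's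
inequality bounds A f by averages of |g|. The values |g| ≤ τ contribute at most a multiple of τ, so
a weak-type estimate bounds τ |{A f > cτ}| by a multiple of the integral of |g| over {|g| > τ},
which tends to 0 (`IsWeakGradient.volume_maxA_le`). -/

namespace BVSobolev

open Metric Topology

/-! ### Covering and choice of radii. -/

/-- A form of Vitali's covering lemma: if the measure `m₁` of an enlarged ball is controlled by the
measure `m₂` of the ball, for a family of balls with centres ranging over `S`, then the measure
`m₁` of `S` is controlled by the measure `m₂` of any set containing these balls. -/
theorem measure_le_of_forall_closedBall_le {d : ℕ} (m₁ m₂ : Measure (E d)) {S T : Set (E d)}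
    {r : E d → ℝ} {R : ℝ} {K : ℝ≥0∞} (hr : ∀ x ∈ S, 0 < r x) (hR : ∀ x ∈ S, r x ≤ R)
    (h : ∀ x ∈ S, m₁ (closedBall x (5 * r x)) ≤ K * m₂ (closedBall x (r x)))
    (hT : ∀ x ∈ S, closedBall x (r x) ⊆ T) : m₁ S ≤ K * m₂ T := by
  obtain ⟨u, huS, hud, hcov⟩ := Vitali.exists_disjoint_subfamily_covering_enlargement_closedBall
    S (fun x => x) r R hR 5 (by norm_num)
  have hu : u.Countable := hud.countable_of_nonempty_interior fun x hx =>
    ⟨x, ball_subset_interior_closedBall (mem_ball_self (hr x (huS hx)))⟩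
  calc m₁ S ≤ m₁ (⋃ x ∈ u, closedBall x (5 * r x)) := by
        refine measure_mono fun x hx => ?_
        obtain ⟨b, hb, hsub⟩ := hcov x hx
        exact mem_biUnion hb (hsub (mem_closedBall_self (hr x hx).le))
    _ ≤ ∑' x : u, m₁ (closedBall x (5 * r x)) := measure_biUnion_le _ hu _
    _ ≤ ∑' x : u, K * m₂ (closedBall x (r x)) := ENNReal.tsum_le_tsum fun x => h x (huS x.2)
    _ = K * m₂ (⋃ x ∈ u, closedBall x (r x)) := by
        rw [ENNReal.tsum_mul_left, measure_biUnion hu hud fun x _ => measurableSet_closedBall]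
    _ ≤ K * m₂ T := by
        gcongr
        exact iUnion₂_subset fun x hx => hT x (huS hx)

theorem volume_closedBall_mul {d : ℕ} (x : E d) {s r : ℝ} (hs : 0 ≤ s) (hr : 0 ≤ r) :
    volume (closedBall x (s * r)) = ENNReal.ofReal (s ^ d) * volume (closedBall x r) := by
  rw [Measure.addHaar_closedBall_mul volume x hs hr, finrank_euclideanSpace_fin,
    Measure.addHaar_closedBall_center volume x r]

theorem volume_closedBall_pos {d : ℕ} (x : E d) {r : ℝ} (hr : 0 < r) :
    volume (closedBall x r) ≠ 0 := (measure_closedBall_pos _ _ hr).ne'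

/-- Balls of bounded volume have bounded radius. -/
theorem exists_forall_radius_le {d : ℕ} (hd : 1 ≤ d) {c : ℝ≥0∞} (hc : c ≠ ⊤) :
    ∃ R : ℝ, ∀ (x : E d) (r : ℝ), volume (closedBall x r) ≤ c → r ≤ R := by
  set w := volume (closedBall (0 : E d) 1)
  have hw : w ≠ 0 := volume_closedBall_pos _ one_pos
  have hwt : w ≠ ⊤ := measure_closedBall_lt_top.ne
  refine ⟨max 1 (c / w).toReal, fun x r h => ?_⟩
  rcases le_total r 1 with h1 | h1
  · exact h1.trans (le_max_left _ _)
  refine le_trans ?_ (le_max_right _ _)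
  have h2 : volume (closedBall x r) = ENNReal.ofReal (r ^ d) * w := by
    have := volume_closedBall_mul x (zero_le_one.trans h1) zero_le_one
    rwa [mul_one, Measure.addHaar_closedBall_center volume x 1] at this
  have h3 : ENNReal.ofReal r ≤ c / w := by
    rw [ENNReal.le_div_iff_mul_le (Or.inl hw) (Or.inl hwt)]
    refine le_trans ?_ (h2.symm.trans_le h)
    gcongr
    -- Positive dimension enters here: for d = 0 the volume would not grow with the radius.
    exact le_self_pow₀ h1 (by omega)
  exact (ENNReal.ofReal_le_iff_le_toReal (ENNReal.div_ne_top hc hw)).1 h3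

/-- If a finite measure has density at least `a` in some ball centred at `x`, then there is such a
ball with the additional property that all balls of at least twice its radius have density at
most `a`. -/
theorem exists_radius_density {d : ℕ} (hd : 1 ≤ d) (m : Measure (E d)) [IsFiniteMeasure m]
    {a : ℝ≥0∞} (ha : a ≠ 0) (x : E d)
    (h : ∃ r, 0 < r ∧ a * volume (closedBall x r) ≤ m (closedBall x r)) :
    ∃ r, 0 < r ∧ a * volume (closedBall x r) ≤ m (closedBall x r) ∧
      ∀ s, 2 * r ≤ s → m (closedBall x s) ≤ a * volume (closedBall x s) := by
  by_cases hat : a = ⊤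
  · obtain ⟨r, hr, h⟩ := h
    refine absurd ((le_of_eq ?_).trans h) (measure_lt_top m _).not_ge
    rw [hat, ENNReal.top_mul (volume_closedBall_pos x hr)]
  set P := {r : ℝ | 0 < r ∧ a * volume (closedBall x r) ≤ m (closedBall x r)}
  obtain ⟨R, hR⟩ := exists_forall_radius_le hd (c := m univ / a)
    (ENNReal.div_ne_top (measure_ne_top _ _) ha)
  have hbdd : BddAbove P := ⟨R, fun r hr => hR x r <| by
    rw [ENNReal.le_div_iff_mul_le (Or.inl ha) (Or.inl hat), mul_comm]
    exact hr.2.trans (measure_mono (subset_univ _))⟩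
  obtain ⟨r₀, hr₀⟩ := h
  have hpos : 0 < sSup P := hr₀.1.trans_le (le_csSup hbdd hr₀)
  -- A radius beyond half the supremum replaces a maximal one: no s ≥ 2r can belong to `P`.
  obtain ⟨r, hr, hlt⟩ := exists_lt_of_lt_csSup ⟨r₀, hr₀⟩ (half_lt_self hpos)
  refine ⟨r, hr.1, hr.2, fun s hs => ?_⟩
  by_contra! hcon
  have : s ≤ sSup P := le_csSup hbdd ⟨by linarith [hr.1], hcon.le⟩
  linarith

/-! ### Testing the derivative with bump functions. -/

/-- Bump functions adapted to a ball, with the expected bound on the derivative. -/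
theorem exists_bump_closedBall (d : ℕ) : ∃ K : ℝ, 0 < K ∧ ∀ (x : E d) (r : ℝ), 0 < r →
    ∃ φ : E d → ℝ, ContDiff ℝ ∞ φ ∧ HasCompactSupport φ ∧ (∀ z, 0 ≤ φ z) ∧ (∀ z, φ z ≤ 1) ∧
      (∀ z ∈ closedBall x r, φ z = 1) ∧ (∀ z ∉ closedBall x (2 * r), φ z = 0) ∧
      (∀ z, ‖fderiv ℝ φ z‖ ≤ K / r) ∧ ∀ z ∉ closedBall x (2 * r), fderiv ℝ φ z = 0 := by
  let ψ : ContDiffBump (0 : E d) := ⟨1, 2, one_pos, one_lt_two⟩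
  have hψ : ContDiff ℝ ∞ ψ := ψ.contDiff
  obtain ⟨K, hK⟩ := (ψ.hasCompactSupport.fderiv ℝ).exists_bound_of_continuous
    (hψ.continuous_fderiv (by simp))
  refine ⟨max K 1, lt_max_of_lt_right one_pos, fun x r hr => ?_⟩
  set φ : E d → ℝ := fun z => ψ (r⁻¹ • (z - x)) with hφ
  have hn : ∀ z, ‖r⁻¹ • (z - x)‖ = r⁻¹ * dist z x := fun z => by
    rw [norm_smul, Real.norm_of_nonneg (inv_nonneg.2 hr.le), dist_eq_norm]
  have h0 : ∀ z ∉ closedBall x (2 * r), φ z = 0 := fun z hz => by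
    refine ψ.zero_of_le_dist ?_
    rw [dist_zero_right, hn, ← div_eq_inv_mul, le_div_iff₀ hr]
    simpa using (not_le.1 hz).le
  have hsm : ContDiff ℝ ∞ φ := hψ.comp (by fun_prop)
  have hder : ∀ z, HasFDerivAt φ (r⁻¹ • fderiv ℝ ψ (r⁻¹ • (z - x))) z := fun z => by
    have h1 : HasFDerivAt (fun z : E d => r⁻¹ • (z - x)) (r⁻¹ • ContinuousLinearMap.id ℝ (E d)) z :=
      ((hasFDerivAt_id z).sub_const x).const_smul r⁻¹
    have h2 := ((hψ.differentiable (by simp)) (r⁻¹ • (z - x))).hasFDerivAt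
    have h3 := h2.comp z h1
    rwa [ContinuousLinearMap.comp_smul, ContinuousLinearMap.comp_id] at h3
  refine ⟨φ, hsm, HasCompactSupport.intro (isCompact_closedBall x (2 * r)) h0, fun z => ψ.nonneg,
    fun z => ψ.le_one, fun z hz => ?_, h0, fun z => ?_, fun z hz => ?_⟩
  · refine ψ.one_of_mem_closedBall ?_
    rw [mem_closedBall_zero_iff, hn, ← div_eq_inv_mul]
    exact (div_le_one hr).2 hz
  · rw [(hder z).fderiv, norm_smul, Real.norm_of_nonneg (inv_nonneg.2 hr.le), div_eq_inv_mul]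
    gcongr
    exact (hK _).trans (le_max_left _ _)
  · have h1 : φ =ᶠ[𝓝 z] fun _ => 0 := by
      filter_upwards [isClosed_closedBall.isOpen_compl.mem_nhds hz] with w hw using h0 w hw
    rw [h1.fderiv_eq]
    simp

/-- Integration by parts against the constant 1. It allows a mean value to be subtracted from f in
the tested integral. -/
theorem integral_fderiv_eq_zero {d : ℕ} {φ : E d → ℝ} (hφ : ContDiff ℝ ∞ φ)
    (hc : HasCompactSupport φ) (v : E d) : ∫ x, fderiv ℝ φ x v = 0 := by
  have h1 : Integrable (fun x => fderiv ℝ φ x v) := by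
    refine Continuous.integrable_of_hasCompactSupport
      ((hφ.continuous_fderiv (by simp)).clm_apply continuous_const) ?_
    exact (hc.fderiv ℝ).comp_left (g := fun L : E d →L[ℝ] ℝ => L v) (by simp)
  have h := integral_bilinear_hasFDerivAt_right_eq_neg_left_of_integrable (μ := volume)
    (f := fun _ : E d => (1 : ℝ)) (f' := fun _ => 0) (g := φ) (g' := fderiv ℝ φ) (v := v)
    (B := ContinuousLinearMap.mul ℝ ℝ) (by simp) (by simpa using h1)
    (by simpa using hφ.continuous.integrable_of_hasCompactSupport hc)
    (fun x _ => hasFDerivAt_const _ _)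
    (fun x _ => (hφ.differentiable (by simp) x).hasFDerivAt)
  simpa using h

theorem setLIntegral_le_maxA {d : ℕ} (f : E d → ℝ) (y : E d) {r : ℝ} (hr : 0 < r) :
    ∫⁻ z in ball y r, ‖f z - ⨍ z in ball y r, f z‖ₑ ≤
      ENNReal.ofReal r * volume (ball y r) * maxA f y := by
  have h1 : (ENNReal.ofReal r)⁻¹ * ⨍⁻ z in ball y r, ‖f z - ⨍ z in ball y r, f z ∂volume‖ₑ ∂volume ≤ maxA f y :=
    le_iSup₂ (f := fun (r : ℝ) (_ : 0 < r) => (ENNReal.ofReal r)⁻¹ *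
      ⨍⁻ z in ball y r, ‖f z - ⨍ z in ball y r, f z ∂volume‖ₑ ∂volume) r hr
  have hr0 : ENNReal.ofReal r ≠ 0 := by simpa using hr
  have hv : volume (ball y r) ≠ 0 := (measure_ball_pos _ _ hr).ne'
  rw [setLAverage_eq, ← ENNReal.div_eq_inv_mul, ENNReal.div_le_iff hr0 ENNReal.ofReal_ne_top,
    ENNReal.div_le_iff hv measure_ball_lt_top.ne] at h1
  refine h1.trans_eq (by ring)

/-- Testing a partial derivative against a bump function bounds it by the oscillation. -/
theorem measure_closedBall_le_maxA (d : ℕ) : ∃ K : ℝ, 0 < K ∧ ∀ (f : E d → ℝ) (v : E d)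
    (m n : Measure (E d)) [IsFiniteMeasure m] [IsFiniteMeasure n], Integrable f → ‖v‖ ≤ 1 →
    (∀ φ : E d → ℝ, ContDiff ℝ ∞ φ → HasCompactSupport φ →
      |∫ x, φ x ∂m - ∫ x, φ x ∂n| = |∫ x, f x * fderiv ℝ φ x v|) →
    ∀ (x : E d) (r : ℝ), 0 < r → ∀ y ∈ closedBall x r, m (closedBall x r) ≤
      n (closedBall x (2 * r)) + ENNReal.ofReal K * volume (closedBall x r) * maxA f y := by
  obtain ⟨K, hK, hbump⟩ := exists_bump_closedBall d
  -- K / r bounds the derivative, 4r is the normalisation in A f at radius 4r, and 4^d is the volume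
  -- ratio.
  refine ⟨K * 4 * 4 ^ d, by positivity, fun f v m n _ _ hf hv hH x r hr y hy => ?_⟩
  obtain ⟨φ, hφ, hφc, hφ0, hφ1, hφin, hφout, hder, hderout⟩ := hbump x r hr
  have hint : ∀ (μ : Measure (E d)) [IsFiniteMeasure μ], Integrable φ μ := fun μ _ =>
    hφ.continuous.integrable_of_hasCompactSupport hφc
  have hm : m.real (closedBall x r) ≤ ∫ z, φ z ∂m := by
    rw [← integral_indicator_one measurableSet_closedBall]
    refine integral_mono ((integrable_const _).indicator measurableSet_closedBall) (hint m)
      fun z => ?_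
    by_cases hz : z ∈ closedBall x r
    · rw [indicator_of_mem hz, hφin z hz]; rfl
    · rw [indicator_of_notMem hz]; exact hφ0 z
  have hn : ∫ z, φ z ∂n ≤ n.real (closedBall x (2 * r)) := by
    rw [← integral_indicator_one measurableSet_closedBall]
    refine integral_mono (hint n) ((integrable_const _).indicator measurableSet_closedBall)
      fun z => ?_
    by_cases hz : z ∈ closedBall x (2 * r)
    · rw [indicator_of_mem hz]; exact hφ1 z
    · rw [indicator_of_notMem hz, hφout z hz]
  -- Centring the average at y brings in A f(y); radius 4r suffices because the support of φ lies
  -- within 3r of y.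
  set c := ⨍ z in ball y (4 * r), f z
  have hdv : Integrable (fun z => fderiv ℝ φ z v) :=
    Continuous.integrable_of_hasCompactSupport
      ((hφ.continuous_fderiv (by simp)).clm_apply continuous_const)
      ((hφc.fderiv ℝ).comp_left (g := fun L : E d →L[ℝ] ℝ => L v) (by simp))
  have hbd : ∀ z, ‖fderiv ℝ φ z v‖ ≤ K / r := fun z =>
    ((fderiv ℝ φ z).le_opNorm v).trans <|
      (mul_le_of_le_one_right (norm_nonneg _) hv).trans (hder z)
  have hfd : Integrable (fun z => f z * fderiv ℝ φ z v) :=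
    hf.mul_bdd hdv.aestronglyMeasurable (Eventually.of_forall hbd)
  have hsub : closedBall x (2 * r) ⊆ ball y (4 * r) := by
    refine fun z hz => mem_ball.2 ?_
    have := dist_triangle_right z y x
    rw [mem_closedBall] at hz hy
    linarith
  have hshift : ∫ z, f z * fderiv ℝ φ z v = ∫ z, (f z - c) * fderiv ℝ φ z v := by
    simp_rw [sub_mul]
    rw [integral_sub hfd (hdv.const_mul c), integral_const_mul, integral_fderiv_eq_zero hφ hφc,
      mul_zero, sub_zero]
  have hest : ‖∫ z, f z * fderiv ℝ φ z v‖ₑ ≤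
      ENNReal.ofReal (K * 4 * 4 ^ d) * volume (closedBall x r) * maxA f y := by
    calc ‖∫ z, f z * fderiv ℝ φ z v‖ₑ ≤ ∫⁻ z, ‖(f z - c) * fderiv ℝ φ z v‖ₑ := by
          rw [hshift]; exact enorm_integral_le_lintegral_enorm _
      _ ≤ ∫⁻ z, (ball y (4 * r)).indicator (fun z => ENNReal.ofReal (K / r) * ‖f z - c‖ₑ) z := by
          refine lintegral_mono fun z => ?_
          by_cases hz : z ∈ ball y (4 * r)
          · rw [indicator_of_mem hz, enorm_mul, mul_comm]
            gcongr
            rw [← ofReal_norm]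
            exact ENNReal.ofReal_le_ofReal (hbd z)
          · rw [hderout z fun h => hz (hsub h)]
            simp
      _ = ENNReal.ofReal (K / r) * ∫⁻ z in ball y (4 * r), ‖f z - c‖ₑ := by
          rw [lintegral_indicator measurableSet_ball,
            lintegral_const_mul' _ _ ENNReal.ofReal_ne_top]
      _ ≤ ENNReal.ofReal (K / r) * (ENNReal.ofReal (4 * r) * volume (ball y (4 * r)) * maxA f y) := by
          gcongr
          exact setLIntegral_le_maxA f y (by positivity)
      _ ≤ ENNReal.ofReal (K / r) * (ENNReal.ofReal (4 * r) *
            (ENNReal.ofReal (4 ^ d) * volume (closedBall x r)) * maxA f y) := by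
          gcongr
          rw [← volume_closedBall_mul x (by norm_num) hr.le, Measure.addHaar_closedBall_center,
            ← Measure.addHaar_closedBall_center volume y]
          exact measure_mono ball_subset_closedBall
      _ = ENNReal.ofReal (K * 4 * 4 ^ d) * volume (closedBall x r) * maxA f y := by
          rw [show K * 4 * 4 ^ d = K / r * ((4 * r) * 4 ^ d) by field_simp,
            ENNReal.ofReal_mul (p := K / r) (by positivity),
            ENNReal.ofReal_mul (p := 4 * r) (by positivity)]
          ring
  refine le_trans ?_ (add_le_add_right hest _)
  have habs := hH φ hφ hφc
  rw [← ofReal_measureReal (μ := m), ← ofReal_measureReal (μ := n), ← ofReal_norm,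
    ← ENNReal.ofReal_add measureReal_nonneg (norm_nonneg _), Real.norm_eq_abs, ← habs]
  refine ENNReal.ofReal_le_ofReal ?_
  linarith [le_abs_self (∫ x, φ x ∂m - ∫ x, φ x ∂n)]

/-! ### The estimate for singular measures. -/

/-- Mutually singular measures have vanishing relative density. -/
theorem ae_eventually_closedBall_le {d : ℕ} {m n : Measure (E d)} [IsFiniteMeasure m]
    [IsLocallyFiniteMeasure n] (h : m ⟂ₘ n) :
    ∀ᵐ x ∂m, ∀ ε : ℝ≥0∞, ε ≠ 0 → ε ≠ ⊤ →
      ∀ᶠ r in 𝓝[>] (0 : ℝ), n (closedBall x r) ≤ ε * m (closedBall x r) := by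
  -- Besicovitch differentiation: the ratio n/m on small balls tends to the density of n with
  -- respect to m, which is zero by singularity.
  filter_upwards [Besicovitch.ae_tendsto_rnDeriv n m, h.symm.rnDeriv_ae_eq_zero]
    with x hx hx0 ε hε hεt
  rw [hx0] at hx
  filter_upwards [hx.eventually_lt_const (pos_iff_ne_zero.2 hε)] with r hr
  exact (ENNReal.div_le_iff_le_mul (Or.inr hεt) (Or.inl (measure_ne_top _ _))).1 hr.le

/-- The central estimate: the mass of a singular measure that is a part of the positive part of a
partial derivative of `f` is controlled by `liminfA f`. -/
theorem measure_univ_le_liminfA (d : ℕ) (hd : 1 ≤ d) : ∃ C : ℝ, 0 < C ∧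
    ∀ (f : E d → ℝ) (v : E d) (m n m' : Measure (E d)) [IsFiniteMeasure m] [IsFiniteMeasure n],
    Integrable f → ‖v‖ ≤ 1 →
    (∀ φ : E d → ℝ, ContDiff ℝ ∞ φ → HasCompactSupport φ →
      |∫ x, φ x ∂m - ∫ x, φ x ∂n| = |∫ x, f x * fderiv ℝ φ x v|) →
    m' ≤ m → m' ⟂ₘ n → m' ⟂ₘ volume → m' univ ≤ ENNReal.ofReal C * liminfA f := by
  obtain ⟨K, hK, hosc⟩ := measure_closedBall_le_maxA d
  refine ⟨5 ^ d * (4 * K), by positivity, fun f v m n m' _ _ hf hv hH hle hsn hsv => ?_⟩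
  have : IsFiniteMeasure m' := isFiniteMeasure_of_le m hle
  -- Chosen so that `n` takes at most half of a·|B(x,r)| on the doubled ball, whose volume is 2^d
  -- times larger.
  set ε : ℝ≥0∞ := ENNReal.ofReal (1 / (2 * 2 ^ d)) with hε
  have hε0 : ε ≠ 0 := by simp [hε]
  -- The smallness of `n` must hold up to a scale independent of x, so that one threshold for t
  -- serves all points; these sets exhaust `m'`-almost everything.
  let G : ℕ → Set (E d) := fun k => {x |
    (∀ a : ℝ≥0∞, a ≠ 0 → a ≠ ⊤ →
      ∀ᶠ r in 𝓝[>] (0 : ℝ), volume (closedBall x r) ≤ a * m' (closedBall x r)) ∧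
    ∀ r : ℝ, 0 < r → r ≤ 1 / ((k : ℝ) + 1) → n (closedBall x r) ≤ ε * m' (closedBall x r)}
  have hGmono : Monotone G := fun k l hkl x hx =>
    ⟨hx.1, fun r hr hrl => hx.2 r hr (hrl.trans (one_div_le_one_div_of_le (by positivity)
      (by gcongr)))⟩
  have hGuniv : m' univ = ⨆ k, m' (G k) := by
    rw [← hGmono.directed_le.measure_iUnion]
    refine (measure_congr ?_).symm
    rw [ae_eq_univ, ← mem_ae_iff]
    filter_upwards [ae_eventually_closedBall_le hsn, ae_eventually_closedBall_le hsv] with x h1 h2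
    have h3 := h1 ε hε0 ENNReal.ofReal_ne_top
    obtain ⟨δ, hδ, hsub⟩ := mem_nhdsGT_iff_exists_Ioc_subset.1 h3
    obtain ⟨k, hk⟩ := exists_nat_one_div_lt (show (0 : ℝ) < δ from hδ)
    exact mem_iUnion.2 ⟨k, h2, fun r hr hrk => hsub ⟨hr, hrk.trans hk.le⟩⟩
  rw [hGuniv]
  refine iSup_le fun k => ?_
  have hev : ∀ᶠ t : ℝ in atTop, m' (G k) ≤ ENNReal.ofReal (5 ^ d * (4 * K)) *
      (ENNReal.ofReal t * volume {x : E d | ENNReal.ofReal t < maxA f x}) := by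
    -- Half the scale of `G k`, since the doubled ball must remain within that scale.
    set δ : ℝ := 1 / ((k : ℝ) + 1) / 2
    have hδ : 0 < δ := by positivity
    set w := volume (closedBall (0 : E d) δ)
    have hw : w ≠ 0 := volume_closedBall_pos _ hδ
    -- Beyond this threshold a·`w` exceeds the total mass of `m'`, which forces every ball of
    -- density at least a to have radius at most δ.
    filter_upwards [eventually_gt_atTop 0,
      eventually_gt_atTop ((m' univ / w).toReal / (4 * K))] with t ht0 ht
    -- The factor 4 makes the oscillation term at most aV/4 if A f(y) ≤ t; with aV/2 from `n` this
    -- totals 3aV/4 < aV, a contradiction.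
    set a : ℝ≥0∞ := ENNReal.ofReal (4 * K * t) with ha
    have ha0 : a ≠ 0 := by simpa [ha] using by positivity
    have hat : a ≠ ⊤ := ENNReal.ofReal_ne_top
    have hsmall : ∀ x r, a * volume (closedBall x r) ≤ m' (closedBall x r) → r ≤ δ := by
      intro x r h
      by_contra! hr
      have h1 : a * w ≤ m' univ := by
        refine le_trans ?_ (h.trans (measure_mono (subset_univ _)))
        gcongr
        rw [show w = volume (closedBall x δ) from
          (Measure.addHaar_closedBall_center volume x δ).symm]
        exact measure_mono (closedBall_subset_closedBall hr.le)
      rw [← ENNReal.le_div_iff_mul_le (Or.inl hw) (Or.inl measure_closedBall_lt_top.ne), ha,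
        ENNReal.ofReal_le_iff_le_toReal (ENNReal.div_ne_top (measure_ne_top _ _) hw)] at h1
      rw [div_lt_iff₀ (by positivity)] at ht
      linarith
    have hex : ∀ x ∈ G k, ∃ r, 0 < r ∧ a * volume (closedBall x r) ≤ m' (closedBall x r) ∧
        ∀ s, 2 * r ≤ s → m' (closedBall x s) ≤ a * volume (closedBall x s) := by
      intro x hx
      refine exists_radius_density hd m' ha0 x ?_
      -- Lebesgue measure being negligible relative to `m'` means that `m'` has infinite density at
      -- x.
      have h1 := hx.1 a⁻¹ (ENNReal.inv_ne_zero.2 hat) (ENNReal.inv_ne_top.2 ha0)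
      obtain ⟨r, hr, hr0⟩ := (h1.and self_mem_nhdsWithin).exists
      refine ⟨r, hr0, ?_⟩
      rwa [← ENNReal.div_eq_inv_mul, ENNReal.le_div_iff_mul_le (Or.inl ha0) (Or.inl hat),
        mul_comm] at hr
    choose! r hr0 hr1 hr2 using hex
    have hvit := measure_le_of_forall_closedBall_le m' volume (S := G k)
      (T := {x : E d | ENNReal.ofReal t < maxA f x}) (r := r) (R := δ)
      (K := a * ENNReal.ofReal (5 ^ d)) hr0 (fun x hx => hsmall x _ (hr1 x hx))
      (fun x hx => ?_) (fun x hx y hy => ?_)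
    · refine hvit.trans_eq ?_
      rw [ha, ENNReal.ofReal_mul (q := t) (by positivity), ENNReal.ofReal_mul (p := 5 ^ d)
        (by positivity)]
      ring
    · refine (hr2 x hx _ (by linarith [hr0 x hx])).trans_eq ?_
      rw [volume_closedBall_mul x (by norm_num) (hr0 x hx).le, mul_assoc]
    · set V := volume (closedBall x (r x))
      have hV0 : V ≠ 0 := volume_closedBall_pos _ (hr0 x hx)
      have hVt : V ≠ ⊤ := measure_closedBall_lt_top.ne
      have h1 := hosc f v m n hf hv hH x (r x) (hr0 x hx) y hy
      have h2 : n (closedBall x (2 * r x)) ≤ ENNReal.ofReal (1 / 2) * (a * V) := by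
        have := hsmall x _ (hr1 x hx)
        calc n (closedBall x (2 * r x)) ≤ ε * m' (closedBall x (2 * r x)) :=
              hx.2 _ (by linarith [hr0 x hx]) (by
                have : 2 * δ = 1 / ((k : ℝ) + 1) := by simp only [δ]; ring
                linarith)
          _ ≤ ε * (a * volume (closedBall x (2 * r x))) := by
              gcongr
              exact hr2 x hx _ le_rfl
          _ = ENNReal.ofReal (1 / 2) * (a * V) := by
              rw [volume_closedBall_mul x (by norm_num) (hr0 x hx).le,
                show (1 / 2 : ℝ) = 1 / (2 * 2 ^ d) * 2 ^ d by field_simp,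
                ENNReal.ofReal_mul (p := 1 / (2 * 2 ^ d)) (by positivity)]
              ring
      have h3 : a * V ≤ ENNReal.ofReal (1 / 2) * (a * V) + ENNReal.ofReal K * V * maxA f y :=
        ((hr1 x hx).trans (hle _)).trans (h1.trans (by gcongr))
      change ENNReal.ofReal t < maxA f y
      by_contra! hcon
      have h4 : a * V ≤ ENNReal.ofReal (1 / 2) * (a * V) + ENNReal.ofReal (1 / 4) * (a * V) := by
        refine h3.trans (add_le_add_right ?_ _)
        calc ENNReal.ofReal K * V * maxA f y ≤ ENNReal.ofReal K * V * ENNReal.ofReal t := by gcongr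
          _ = ENNReal.ofReal (1 / 4) * (a * V) := by
            rw [ha, show 4 * K * t = 4 * (K * t) by ring, ← mul_assoc (ENNReal.ofReal (1 / 4)),
              ← ENNReal.ofReal_mul (by norm_num), show 1 / 4 * (4 * (K * t)) = K * t by ring,
              ENNReal.ofReal_mul hK.le]
            ring
      rw [← add_mul, ← ENNReal.ofReal_add (by norm_num) (by norm_num)] at h4
      have h5 : a * V < a * V := by
        refine h4.trans_lt ?_
        conv_rhs => rw [← one_mul (a * V)]
        refine ENNReal.mul_lt_mul_left (mul_ne_zero ha0 hV0) (ENNReal.mul_ne_top hat hVt) ?_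
        rw [← ENNReal.ofReal_one]
        exact (ENNReal.ofReal_lt_ofReal_iff one_pos).2 (by norm_num)
      exact lt_irrefl _ h5
  calc m' (G k) ≤ liminf (fun t : ℝ => ENNReal.ofReal (5 ^ d * (4 * K)) *
        (ENNReal.ofReal t * volume {x : E d | ENNReal.ofReal t < maxA f x})) atTop :=
        le_liminf_of_le (by isBoundedDefault) hev
    _ = ENNReal.ofReal (5 ^ d * (4 * K)) * liminfA f :=
        ENNReal.liminf_const_mul_of_ne_top ENNReal.ofReal_ne_top

/-! ### Reduction of the vector measure to its scalar components. -/

/-- The `i`-th component of a vector measure. -/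
noncomputable def component {d : ℕ} (μ : VectorMeasure (E d) (E d)) (i : Fin d) : SignedMeasure (E d) :=
  μ.mapRange (EuclideanSpace.proj i : E d →L[ℝ] ℝ).toLinearMap.toAddMonoidHom
    (EuclideanSpace.proj i : E d →L[ℝ] ℝ).continuous

/-- The positive part of the `i`-th component of a vector measure. -/
noncomputable def posComponent {d : ℕ} (μ : VectorMeasure (E d) (E d)) (i : Fin d) : Measure (E d) :=
  (component μ i).toJordanDecomposition.posPart

/-- The negative part of the `i`-th component of a vector measure. -/
noncomputable def negComponent {d : ℕ} (μ : VectorMeasure (E d) (E d)) (i : Fin d) : Measure (E d) :=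
  (component μ i).toJordanDecomposition.negPart

instance {d : ℕ} (μ : VectorMeasure (E d) (E d)) (i : Fin d) :
    IsFiniteMeasure (posComponent μ i) := by
  unfold posComponent; infer_instance

instance {d : ℕ} (μ : VectorMeasure (E d) (E d)) (i : Fin d) :
    IsFiniteMeasure (negComponent μ i) := by
  unfold negComponent; infer_instance

theorem component_apply {d : ℕ} (μ : VectorMeasure (E d) (E d)) (i : Fin d) (s : Set (E d)) :
    component μ i s = μ s i := rfl

theorem apply_eq_sub_component {d : ℕ} (μ : VectorMeasure (E d) (E d)) (i : Fin d)
    {s : Set (E d)} (hs : MeasurableSet s) :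
    μ s i = (posComponent μ i).real s - (negComponent μ i).real s := by
  rw [← component_apply, SignedMeasure.apply_eq_posPart_real_sub_negPart_real _ hs]
  rfl

theorem posComponent_mutuallySingular {d : ℕ} (μ : VectorMeasure (E d) (E d)) (i : Fin d) :
    posComponent μ i ⟂ₘ negComponent μ i :=
  (component μ i).toJordanDecomposition.mutuallySingular

theorem posComponent_add_negComponent_le {d : ℕ} (μ : VectorMeasure (E d) (E d)) (i : Fin d) :
    posComponent μ i + negComponent μ i ≤ μ.variation := by
  change (component μ i).totalVariation ≤ _
  rw [SignedMeasure.totalVariation_eq_variation]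
  refine VectorMeasure.variation_le_of_forall_enorm_le fun s _ => ?_
  refine le_trans ?_ (μ.enorm_measure_le_variation s)
  rw [component_apply, ← ofReal_norm, ← ofReal_norm]
  exact ENNReal.ofReal_le_ofReal (PiLp.norm_apply_le (μ s) i)

theorem posComponent_le {d : ℕ} (μ : VectorMeasure (E d) (E d)) (i : Fin d) :
    posComponent μ i ≤ μ.variation :=
  le_trans (Measure.le_add_right le_rfl) (posComponent_add_negComponent_le μ i)

theorem negComponent_le {d : ℕ} (μ : VectorMeasure (E d) (E d)) (i : Fin d) :
    negComponent μ i ≤ μ.variation :=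
  le_trans (Measure.le_add_left le_rfl) (posComponent_add_negComponent_le μ i)

theorem variation_le_sum_component {d : ℕ} (μ : VectorMeasure (E d) (E d)) :
    μ.variation ≤ ∑ i, (posComponent μ i + negComponent μ i) := by
  refine VectorMeasure.variation_le_of_forall_enorm_le fun s _ => ?_
  rw [Measure.finsetSum_apply]
  calc ‖μ s‖ₑ = ‖∑ i, EuclideanSpace.single i (μ s i)‖ₑ := by
        congr 1
        ext j
        simp
    _ ≤ ∑ i, ‖EuclideanSpace.single i (μ s i)‖ₑ := enorm_sum_le _ _
    _ ≤ ∑ i, (posComponent μ i + negComponent μ i) s := by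
        refine Finset.sum_le_sum fun i _ => ?_
        refine le_trans (le_of_eq ?_) ((component μ i).enorm_le_totalVariation s)
        rw [← ofReal_norm, ← ofReal_norm, PiLp.norm_single, component_apply]

theorem tendsto_lintegral_sub_L1 {α : Type*} [MeasurableSpace α] {μ ν : Measure α} (h : ν ≤ μ)
    (f : α →₁[μ] ℝ) :
    Tendsto (fun g : α →₁[μ] ℝ => ∫⁻ x, ‖g x - f x‖ₑ ∂ν) (𝓝 f) (𝓝 0) := by
  have h1 : Tendsto (fun g : α →₁[μ] ℝ => ∫⁻ x, ‖g x - f x‖ₑ ∂μ) (𝓝 f) (𝓝 0) := by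
    have := (tendsto_iff_edist_tendsto_0 (f := id) (l := 𝓝 f) (y := f)).1 tendsto_id
    refine this.congr fun g => ?_
    rw [id, Lp.edist_def, eLpNorm_one_eq_lintegral_enorm]
    rfl
  exact tendsto_of_tendsto_of_tendsto_of_le_of_le tendsto_const_nhds h1 (fun _ => zero_le)
    fun g => lintegral_mono' h le_rfl

/-- Both sides are additive and continuous on L¹ of the variation, and they agree on multiples of
indicators, hence everywhere. -/
theorem integral_apply_eq_sub_component {d : ℕ} (μ : VectorMeasure (E d) (E d)) (i : Fin d)
    {φ : E d → ℝ} (hφ : Integrable φ μ.variation) :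
    (∫ᵛ x, φ x ∂•μ) i = ∫ x, φ x ∂(posComponent μ i) - ∫ x, φ x ∂(negComponent μ i) := by
  refine Integrable.induction (μ := μ.variation) (fun φ : E d → ℝ => (∫ᵛ x, φ x ∂•μ) i =
    ∫ x, φ x ∂(posComponent μ i) - ∫ x, φ x ∂(negComponent μ i)) ?_ ?_ ?_ ?_ hφ
  · intro c s hs _
    rw [VectorMeasure.integral_eq_setToFun, setToFun_indicator_const _ hs (measure_ne_top _ _),
      integral_indicator_const _ hs, integral_indicator_const _ hs]
    change (c • μ s) i = _
    rw [PiLp.smul_apply, apply_eq_sub_component μ i hs, smul_eq_mul, smul_eq_mul, smul_eq_mul]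
    ring
  · intro f g _ hf hg hf' hg'
    simp only [Pi.add_apply]
    rw [VectorMeasure.integral_fun_add hf hg, PiLp.add_apply, hf', hg',
      integral_add (hf.mono_measure (posComponent_le μ i)) (hg.mono_measure (posComponent_le μ i)),
      integral_add (hf.mono_measure (negComponent_le μ i)) (hg.mono_measure (negComponent_le μ i))]
    ring
  · have hcont : ∀ ν : Measure (E d), ν ≤ μ.variation →
        Continuous fun f : E d →₁[μ.variation] ℝ => ∫ x, f x ∂ν := fun ν hν =>
      continuous_iff_continuousAt.2 fun f => tendsto_integral_of_L1 _
        ((L1.integrable_coeFn f).mono_measure hν).aestronglyMeasurable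
        (Eventually.of_forall fun g => (L1.integrable_coeFn g).mono_measure hν)
        (tendsto_lintegral_sub_L1 hν f)
    refine isClosed_eq ?_ ((hcont _ (posComponent_le μ i)).sub (hcont _ (negComponent_le μ i)))
    exact (EuclideanSpace.proj i : E d →L[ℝ] ℝ).continuous.comp VectorMeasure.continuous_integral
  · intro f g hfg _ hf
    rw [← VectorMeasure.integral_congr_ae hfg, hf,
      integral_congr_ae (Measure.absolutelyContinuous_of_le (posComponent_le μ i) hfg),
      integral_congr_ae (Measure.absolutelyContinuous_of_le (negComponent_le μ i) hfg)]

theorem integral_smul_gradient_apply {d : ℕ} {f φ : E d → ℝ} (hf : Integrable f)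
    (hφ : ContDiff ℝ ∞ φ) (hc : HasCompactSupport φ) (i : Fin d) :
    (∫ x, f x • ∇ φ x) i = ∫ x, f x * fderiv ℝ φ x (EuclideanSpace.single i 1) := by
  have hgr : Continuous (∇ φ) := by
    unfold gradient
    exact (InnerProductSpace.toDual ℝ (E d)).symm.continuous.comp
      (hφ.continuous_fderiv (by simp))
  have hgc : HasCompactSupport (∇ φ) := by
    unfold gradient
    exact (hc.fderiv ℝ).comp_left (g := (InnerProductSpace.toDual ℝ (E d)).symm) (map_zero _)
  obtain ⟨K, hK⟩ := hgc.exists_bound_of_continuous hgr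
  have hint : Integrable (fun x => f x • ∇ φ x) :=
    hf.smul_bdd K hgr.aestronglyMeasurable (Eventually.of_forall hK)
  have := (EuclideanSpace.proj i : E d →L[ℝ] ℝ).integral_comp_comm hint
  change _ = (∫ x, f x • ∇ φ x) i at this
  rw [← this]
  refine integral_congr_ae (Eventually.of_forall fun x => ?_)
  change (f x • ∇ φ x) i = _
  rw [PiLp.smul_apply, smul_eq_mul]
  congr 1
  have h2 := inner_gradient_left (𝕜 := ℝ) (f := φ) (x := x) (y := EuclideanSpace.single i (1 : ℝ))
  rw [← h2, EuclideanSpace.inner_single_right]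
  simp

/-- Up to absolute values, this is the hypothesis that `measure_univ_le_liminfA` needs in a
coordinate direction. -/
theorem IsGradientMeasure.component_eq {d : ℕ} {f : E d → ℝ} {μ : VectorMeasure (E d) (E d)}
    (h : IsGradientMeasure f μ) (hf : Integrable f) (i : Fin d) {φ : E d → ℝ}
    (hφ : ContDiff ℝ ∞ φ) (hc : HasCompactSupport φ) :
    ∫ x, φ x ∂(posComponent μ i) - ∫ x, φ x ∂(negComponent μ i) =
      - ∫ x, f x * fderiv ℝ φ x (EuclideanSpace.single i 1) := by
  rw [← integral_apply_eq_sub_component μ i (hφ.continuous.integrable_of_hasCompactSupport hc),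
    h φ hφ hc, PiLp.neg_apply, integral_smul_gradient_apply hf hφ hc]

/-! ### The lower bound and its converse consequence. -/

/-- The lower bound for `liminfA f` in terms of the singular part of the gradient. -/
theorem variation_singularPart_le (d : ℕ) (hd : 1 ≤ d) : ∃ C : ℝ, 0 < C ∧
    ∀ (f : E d → ℝ) (μ : VectorMeasure (E d) (E d)), Integrable f → IsGradientMeasure f μ →
      (singularPart μ).variation univ ≤ ENNReal.ofReal C * liminfA f := by
  obtain ⟨C, hC, h⟩ := measure_univ_le_liminfA d hd
  refine ⟨d * (C + C), by positivity, fun f μ hf hμ => ?_⟩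
  set hN := Measure.mutuallySingular_singularPart μ.variation (volume : Measure (E d))
  set N := hN.nullSetᶜ
  have hNm : MeasurableSet N := hN.measurableSet_nullSet.compl
  have hsing : ∀ m : Measure (E d), m.restrict N ⟂ₘ volume := fun m =>
    ⟨Nᶜ, hNm.compl, by simp [Measure.restrict_apply hNm.compl], by
      rw [compl_compl]; exact hN.measure_compl_nullSet⟩
  have hv : ∀ i : Fin d, ‖(EuclideanSpace.single i (1 : ℝ) : E d)‖ ≤ 1 := fun i => by simp
  have hpos : ∀ i, (posComponent μ i).restrict N univ ≤ ENNReal.ofReal C * liminfA f := fun i =>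
    h f (EuclideanSpace.single i 1) (posComponent μ i) (negComponent μ i) _ hf (hv i)
      (fun φ hφ hc => by rw [hμ.component_eq hf i hφ hc, abs_neg]) Measure.restrict_le_self
      ((posComponent_mutuallySingular μ i).mono_ac Measure.restrict_le_self.absolutelyContinuous
        .rfl) (hsing _)
  -- The absolute values in the tested identity make the two Jordan parts interchangeable.
  have hneg : ∀ i, (negComponent μ i).restrict N univ ≤ ENNReal.ofReal C * liminfA f := fun i =>
    h f (EuclideanSpace.single i 1) (negComponent μ i) (posComponent μ i) _ hf (hv i)
      (fun φ hφ hc => by rw [abs_sub_comm, hμ.component_eq hf i hφ hc, abs_neg])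
      Measure.restrict_le_self
      ((posComponent_mutuallySingular μ i).symm.mono_ac
        Measure.restrict_le_self.absolutelyContinuous .rfl) (hsing _)
  have hvar : (singularPart μ).variation univ = μ.variation N := by
    rw [singularPart, VectorMeasure.variation_restrict hNm, Measure.restrict_apply_univ]
  calc (singularPart μ).variation univ = μ.variation N := hvar
    _ ≤ (∑ i, (posComponent μ i + negComponent μ i)) N := variation_le_sum_component μ N
    _ = ∑ i, ((posComponent μ i).restrict N univ + (negComponent μ i).restrict N univ) := by
        simp [Measure.finsetSum_apply]
    _ ≤ ∑ _i : Fin d, (ENNReal.ofReal C * liminfA f + ENNReal.ofReal C * liminfA f) :=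
        Finset.sum_le_sum fun i _ => add_le_add (hpos i) (hneg i)
    _ = ENNReal.ofReal (d * (C + C)) * liminfA f := by
        rw [Finset.sum_const, Finset.card_univ, Fintype.card_fin, nsmul_eq_mul,
          ENNReal.ofReal_mul (by positivity), ENNReal.ofReal_natCast, ENNReal.ofReal_add hC.le hC.le]
        ring

/-- A function of bounded variation whose gradient has no singular part is a Sobolev function. -/
theorem memW11_of_variation_singularPart_eq_zero {d : ℕ} {f : E d → ℝ}
    {μ : VectorMeasure (E d) (E d)} (hf : MemLp f 1 volume) (hμ : IsGradientMeasure f μ)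
    (h0 : (singularPart μ).variation univ = 0) : MemW11 f := by
  have hac : μ.variation ≪ (volume : Measure (E d)) := by
    set hN := Measure.mutuallySingular_singularPart μ.variation (volume : Measure (E d))
    have hNm : MeasurableSet hN.nullSetᶜ := hN.measurableSet_nullSet.compl
    have h1 : μ.variation hN.nullSetᶜ = 0 := by
      rwa [singularPart, VectorMeasure.variation_restrict hNm, Measure.restrict_apply_univ] at h0
    refine Measure.AbsolutelyContinuous.mk fun s hs hs0 => ?_
    have h2 : μ.variation (s ∩ hN.nullSet) = 0 := by
      have h4 := congrArg (fun m : Measure (E d) => m (s ∩ hN.nullSet))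
        (Measure.haveLebesgueDecomposition_add μ.variation (volume : Measure (E d)))
      simp only [Measure.add_apply] at h4
      rw [h4, measure_mono_null inter_subset_right hN.measure_nullSet, zero_add]
      exact withDensity_absolutelyContinuous _ _ (measure_mono_null inter_subset_left hs0)
    rw [← measure_inter_add_sdiff s hN.measurableSet_nullSet, h2, zero_add]
    exact measure_mono_null (fun x hx => hx.2) h1
  have hfi : Integrable f := memLp_one_iff_integrable.1 hf
  set p : Fin d → E d → ℝ := fun i x => ((posComponent μ i).rnDeriv volume x).toReal
  set q : Fin d → E d → ℝ := fun i x => ((negComponent μ i).rnDeriv volume x).toReal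
  have hp : ∀ i, Integrable (p i) := fun i => Measure.integrable_toReal_rnDeriv
  have hq : ∀ i, Integrable (q i) := fun i => Measure.integrable_toReal_rnDeriv
  have hpac : ∀ i, posComponent μ i ≪ volume := fun i =>
    (posComponent_le μ i).absolutelyContinuous.trans hac
  have hqac : ∀ i, negComponent μ i ≪ volume := fun i =>
    (negComponent_le μ i).absolutelyContinuous.trans hac
  -- The Radon–Nikodym density of the gradient, assembled from the Jordan parts of its components.
  set g : E d → E d := fun x => WithLp.toLp 2 fun i => p i x - q i x
  have hg : Integrable g := Integrable.of_eval_piLp fun i => (hp i).sub (hq i)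
  refine ⟨hf, g, memLp_one_iff_integrable.2 hg, fun φ hφ hc => ?_⟩
  obtain ⟨K, hK⟩ := hc.exists_bound_of_continuous hφ.continuous
  have hint : Integrable (fun x => φ x • g x) :=
    hg.bdd_smul K hφ.continuous.aestronglyMeasurable (Eventually.of_forall hK)
  have hmul : ∀ u : E d → ℝ, Integrable u → Integrable fun x => u x * φ x := fun u hu =>
    hu.mul_bdd hφ.continuous.aestronglyMeasurable (Eventually.of_forall hK)
  ext i
  have h1 := (EuclideanSpace.proj i : E d →L[ℝ] ℝ).integral_comp_comm hint
  change _ = (∫ x, φ x • g x) i at h1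
  rw [← h1, PiLp.neg_apply, integral_smul_gradient_apply hfi hφ hc, ← hμ.component_eq hfi i hφ hc,
    ← integral_rnDeriv_smul (hpac i), ← integral_rnDeriv_smul (hqac i)]
  refine Eq.trans ?_ (integral_sub (hmul _ (hp i)) (hmul _ (hq i)))
  refine integral_congr_ae (Eventually.of_forall fun x => ?_)
  change φ x * (p i x - q i x) = p i x * φ x - q i x * φ x
  ring

/-! ### Poincaré's inequality on balls for C¹ functions. -/

theorem lintegral_comp_smul_add {d : ℕ} {h : E d → ℝ≥0∞} (hh : Measurable h) {s : ℝ} (hs : 0 < s)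
    (w : E d) : ∫⁻ x, h (s • x + w) = ENNReal.ofReal ((s ^ d)⁻¹) * ∫⁻ x, h x := by
  have h1 := lintegral_map (μ := volume) (f := fun x => h (x + w)) (g := fun x : E d => s • x)
    (by fun_prop) (by fun_prop)
  rw [← h1, Measure.map_addHaar_smul volume hs.ne', lintegral_smul_measure,
    lintegral_add_right_eq_self, finrank_euclideanSpace_fin, abs_of_pos (by positivity), smul_eq_mul]

/-- By convexity the substitution z = s a + t c keeps the ball inside itself, and its Jacobian
factor s^(-d) is at most 2^d. -/
theorem setLIntegral_comp_segment_le {d : ℕ} {h : E d → ℝ≥0∞} (hh : Measurable h) {x c : E d}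
    {r s t : ℝ} (hs : 1 / 2 ≤ s) (ht : 0 ≤ t) (hst : s + t = 1) (hc : c ∈ ball x r) :
    ∫⁻ a in ball x r, h (s • a + t • c) ≤ ENNReal.ofReal (2 ^ d) * ∫⁻ z in ball x r, h z := by
  have hs0 : 0 < s := by linarith
  calc ∫⁻ a in ball x r, h (s • a + t • c)
      ≤ ∫⁻ a, (ball x r).indicator h (s • a + t • c) := by
        rw [← lintegral_indicator measurableSet_ball]
        refine lintegral_mono fun a => ?_
        by_cases ha : a ∈ ball x r
        · rw [indicator_of_mem ha, indicator_of_mem]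
          exact convex_ball x r ha hc hs0.le ht hst
        · rw [indicator_of_notMem ha]
          exact zero_le
    _ = ENNReal.ofReal ((s ^ d)⁻¹) * ∫⁻ z in ball x r, h z := by
        rw [lintegral_comp_smul_add (hh.indicator measurableSet_ball) hs0,
          lintegral_indicator measurableSet_ball]
    _ ≤ ENNReal.ofReal (2 ^ d) * ∫⁻ z in ball x r, h z := by
        gcongr
        rw [← inv_pow]
        gcongr
        rw [inv_le_comm₀ hs0 two_pos]
        linarith

/-- One of t and 1 - t is at least 1/2; integrating first in the variable it multiplies keeps the
bound uniform in t. -/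
theorem setLIntegral_setLIntegral_comp_segment_le {d : ℕ} {h : E d → ℝ≥0∞} (hh : Measurable h)
    {x : E d} {r t : ℝ} (ht : t ∈ Ioc (0 : ℝ) 1) :
    ∫⁻ a in ball x r, ∫⁻ b in ball x r, h (t • a + (1 - t) • b) ≤
      ENNReal.ofReal (2 ^ d) * (∫⁻ z in ball x r, h z) * volume (ball x r) := by
  rcases le_total (1 / 2) t with h1 | h1
  · rw [lintegral_lintegral_swap (by fun_prop)]
    calc _ ≤ ∫⁻ _b in ball x r, ENNReal.ofReal (2 ^ d) * ∫⁻ z in ball x r, h z :=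
          setLIntegral_mono' measurableSet_ball fun b hb =>
            setLIntegral_comp_segment_le hh h1 (by linarith [ht.2]) (by ring) hb
      _ = _ := by rw [setLIntegral_const]
  · calc _ ≤ ∫⁻ _a in ball x r, ENNReal.ofReal (2 ^ d) * ∫⁻ z in ball x r, h z :=
          setLIntegral_mono' measurableSet_ball fun a ha => by
            simp_rw [add_comm (t • a)]
            exact setLIntegral_comp_segment_le hh (by linarith) ht.1.le (by ring) ha
      _ = _ := by rw [setLIntegral_const]

theorem enorm_sub_le_lintegral_fderiv {d : ℕ} {u : E d → ℝ} (hu : ContDiff ℝ 1 u) (a b : E d) :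
    ‖u a - u b‖ₑ ≤ ∫⁻ t in Ioc (0 : ℝ) 1, ‖fderiv ℝ u (t • a + (1 - t) • b)‖ₑ * ‖a - b‖ₑ := by
  have hder : ∀ t : ℝ, HasDerivAt (fun t : ℝ => u (t • a + (1 - t) • b))
      (fderiv ℝ u (t • a + (1 - t) • b) (a - b)) t := fun t => by
    have h1 : HasDerivAt (fun t : ℝ => t • a + (1 - t) • b) (a - b) t := by
      have h2 := ((hasDerivAt_id t).smul_const a).add
        (((hasDerivAt_id t).const_sub 1).smul_const b)
      convert! h2 using 1
      simp [sub_eq_add_neg]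
    exact (hu.differentiable one_ne_zero _).hasFDerivAt.comp_hasDerivAt t h1
  have hcont : Continuous fun t : ℝ => fderiv ℝ u (t • a + (1 - t) • b) (a - b) :=
    ((hu.continuous_fderiv one_ne_zero).comp (by fun_prop)).clm_apply continuous_const
  have hftc := intervalIntegral.integral_eq_sub_of_hasDerivAt (fun t _ => hder t)
    (hcont.intervalIntegrable 0 1)
  simp only [one_smul, sub_self, zero_smul, add_zero, sub_zero, zero_add] at hftc
  rw [← hftc, intervalIntegral.integral_of_le zero_le_one]
  refine (enorm_integral_le_lintegral_enorm _).trans (lintegral_mono fun t => ?_)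
  exact ContinuousLinearMap.le_opENorm _ _

/-- Poincaré's inequality on balls for functions of class `C¹`, in a two-point form. -/
theorem setLIntegral_setLIntegral_enorm_sub_le {d : ℕ} {u : E d → ℝ} (hu : ContDiff ℝ 1 u)
    (x : E d) (r : ℝ) :
    ∫⁻ a in ball x r, ∫⁻ b in ball x r, ‖u a - u b‖ₑ ≤
      ENNReal.ofReal (2 * r) * (ENNReal.ofReal (2 ^ d) * (∫⁻ z in ball x r, ‖fderiv ℝ u z‖ₑ) *
        volume (ball x r)) := by
  set h : E d → ℝ≥0∞ := fun z => ‖fderiv ℝ u z‖ₑ with hh'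
  have hh : Measurable h := (hu.continuous_fderiv one_ne_zero).measurable.enorm
  have hpt : ∀ a ∈ ball x r, ∀ b ∈ ball x r, ‖u a - u b‖ₑ ≤
      ENNReal.ofReal (2 * r) * ∫⁻ t in Ioc (0 : ℝ) 1, h (t • a + (1 - t) • b) := by
    intro a ha b hb
    refine (enorm_sub_le_lintegral_fderiv hu a b).trans ?_
    rw [lintegral_mul_const' _ _ enorm_ne_top, mul_comm]
    gcongr
    rw [← ofReal_norm, ← dist_eq_norm]
    refine ENNReal.ofReal_le_ofReal ?_
    rw [mem_ball] at ha hb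
    linarith [dist_triangle_right a b x]
  calc ∫⁻ a in ball x r, ∫⁻ b in ball x r, ‖u a - u b‖ₑ
      ≤ ∫⁻ a in ball x r, ∫⁻ b in ball x r,
          ENNReal.ofReal (2 * r) * ∫⁻ t in Ioc (0 : ℝ) 1, h (t • a + (1 - t) • b) :=
        setLIntegral_mono' measurableSet_ball fun a ha =>
          setLIntegral_mono' measurableSet_ball fun b hb => hpt a ha b hb
    _ = ENNReal.ofReal (2 * r) * ∫⁻ t in Ioc (0 : ℝ) 1, ∫⁻ a in ball x r, ∫⁻ b in ball x r,
          h (t • a + (1 - t) • b) := by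
        have hm : Measurable fun p : (ℝ × E d) × E d =>
            h (p.1.1 • p.1.2 + (1 - p.1.1) • p.2) := by fun_prop
        have hm2 : Measurable fun p : ℝ × E d => ∫⁻ b in ball x r, h (p.1 • p.2 + (1 - p.1) • b) :=
          hm.lintegral_prod_right'
        simp_rw [lintegral_const_mul' _ _ ENNReal.ofReal_ne_top]
        congr 1
        refine Eq.trans (lintegral_congr fun a => ?_) (lintegral_lintegral_swap
          (f := fun (t : ℝ) (a : E d) => ∫⁻ b in ball x r, h (t • a + (1 - t) • b))
          hm2.aemeasurable).symm
        exact lintegral_lintegral_swap (by fun_prop)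
    _ ≤ ENNReal.ofReal (2 * r) * ∫⁻ _t in Ioc (0 : ℝ) 1,
          ENNReal.ofReal (2 ^ d) * (∫⁻ z in ball x r, h z) * volume (ball x r) := by
        gcongr ENNReal.ofReal (2 * r) * ?_
        exact setLIntegral_mono' measurableSet_Ioc fun t ht =>
          setLIntegral_setLIntegral_comp_segment_le hh ht
    _ = _ := by simp

/-! ### Mollification and Poincaré's inequality for Sobolev functions. -/

/-- The gradient of a mollification is the mollification of the weak gradient. -/
theorem enorm_fderiv_convolution_le {d : ℕ} {f φ : E d → ℝ} {g : E d → E d} (hf : Integrable f)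
    (hfg : IsWeakGradient f g) (hφ : ContDiff ℝ ∞ φ) (hc : HasCompactSupport φ) (x : E d) :
    ‖fderiv ℝ (convolution φ f (ContinuousLinearMap.lsmul ℝ ℝ) volume) x‖ₑ ≤
      ∫⁻ t, ‖φ (x - t)‖ₑ * ‖g t‖ₑ := by
  set L : ℝ →L[ℝ] ℝ →L[ℝ] ℝ := (ContinuousLinearMap.lsmul ℝ ℝ).flip
  set ψ : E d → ℝ := fun t => φ (x - t) with hψ
  have hψs : ContDiff ℝ ∞ ψ := hφ.comp (by fun_prop)
  have hψc : HasCompactSupport ψ := hc.comp_homeomorph (Homeomorph.subLeft x)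
  have hψd : ∀ t v, fderiv ℝ ψ t v = - fderiv ℝ φ (x - t) v := fun t v => by
    have h1 : HasFDerivAt (fun t : E d => x - t) (-ContinuousLinearMap.id ℝ (E d)) t :=
      (hasFDerivAt_id t).const_sub x
    have h2 := ((hφ.differentiable (by simp)) (x - t)).hasFDerivAt.comp t h1
    rw [show fderiv ℝ ψ t = _ from h2.fderiv]
    simp
  have hder := hc.hasFDerivAt_convolution_right L hf.locallyIntegrable
    (hφ.of_le (by exact_mod_cast le_top)) x
  rw [convolution_flip] at hder
  rw [hder.fderiv]
  have hgr : Continuous (∇ ψ) := by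
    unfold gradient
    exact (InnerProductSpace.toDual ℝ (E d)).symm.continuous.comp
      (hψs.continuous_fderiv (by simp))
  have hgc : HasCompactSupport (∇ ψ) := by
    unfold gradient
    exact (hψc.fderiv ℝ).comp_left (g := (InnerProductSpace.toDual ℝ (E d)).symm) (map_zero _)
  obtain ⟨K, hK⟩ := hgc.exists_bound_of_continuous hgr
  have hint : Integrable (fun t => f t • ∇ ψ t) :=
    hf.smul_bdd K hgr.aestronglyMeasurable (Eventually.of_forall hK)
  -- The derivative falls on the mollifier; the weak gradient identity for the test function `ψ`
  -- then transfers it to f.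
  have happ : ∀ v, (convolution f (fderiv ℝ φ) (L.precompR (E d)) volume x) v =
      inner ℝ v (∫ t, ψ t • g t) := fun v => by
    rw [convolution_precompR_apply L hf.locallyIntegrable (hc.fderiv ℝ)
      (hφ.continuous_fderiv (by simp)), hfg ψ hψs hψc, inner_neg_right, ← integral_inner hint,
      ← integral_neg]
    refine integral_congr_ae (Eventually.of_forall fun t => ?_)
    change fderiv ℝ φ (x - t) v * f t = -inner ℝ v (f t • ∇ ψ t)
    rw [inner_smul_right, inner_gradient_right]
    simp only [hψd]
    simp
    ring
  refine le_trans ?_ ((enorm_integral_le_lintegral_enorm (μ := volume) (fun t => ψ t • g t)).trans_eq ?_)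
  · rw [← ofReal_norm, ← ofReal_norm]
    refine ENNReal.ofReal_le_ofReal (ContinuousLinearMap.opNorm_le_bound _ (norm_nonneg _)
      fun v => ?_)
    rw [happ, mul_comm]
    exact norm_inner_le_norm _ _
  · simp_rw [enorm_smul, hψ]

/-- By Tonelli: the mollifier has mass 1 and its support has radius at most r, so only values of g
within 2r of x contribute. -/
theorem setLIntegral_enorm_fderiv_convolution_le {d : ℕ} {f : E d → ℝ} {g : E d → E d}
    (hf : Integrable f) (hg : StronglyMeasurable g) (hfg : IsWeakGradient f g)
    (φ : ContDiffBump (0 : E d)) (x : E d) {r : ℝ} (hr : φ.rOut ≤ r) :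
    ∫⁻ z in ball x r, ‖fderiv ℝ (convolution (φ.normed volume) f
      (ContinuousLinearMap.lsmul ℝ ℝ) volume) z‖ₑ ≤ ∫⁻ t in closedBall x (2 * r), ‖g t‖ₑ := by
  set η : E d → ℝ := φ.normed volume
  have hηc : Continuous η := φ.continuous_normed
  have hη1 : ∫⁻ z, ‖η z‖ₑ = 1 := by
    rw [← ofReal_integral_norm_eq_lintegral_enorm φ.integrable_normed]
    simp_rw [Real.norm_of_nonneg (φ.nonneg_normed _)]
    rw [φ.integral_normed, ENNReal.ofReal_one]
  have hηm : Measurable fun p : E d × E d => ‖η (p.1 - p.2)‖ₑ :=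
    (hηc.comp (continuous_fst.sub continuous_snd)).measurable.enorm
  calc _ ≤ ∫⁻ z in ball x r, ∫⁻ t, ‖η (z - t)‖ₑ * ‖g t‖ₑ :=
        lintegral_mono fun z => enorm_fderiv_convolution_le hf hfg φ.contDiff_normed
          φ.hasCompactSupport_normed z
    _ = ∫⁻ t, ∫⁻ z in ball x r, ‖η (z - t)‖ₑ * ‖g t‖ₑ :=
        lintegral_lintegral_swap
          (hηm.mul (hg.measurable.comp measurable_snd).enorm).aemeasurable
    _ ≤ ∫⁻ t, (closedBall x (2 * r)).indicator (fun t => ‖g t‖ₑ) t := by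
        refine lintegral_mono fun t => ?_
        rw [lintegral_mul_const' _ _ enorm_ne_top]
        by_cases ht : t ∈ closedBall x (2 * r)
        · rw [indicator_of_mem ht]
          refine mul_le_of_le_one_left' ?_
          refine (setLIntegral_le_lintegral _ _).trans ?_
          rw [lintegral_sub_right_eq_self (fun z => ‖η z‖ₑ) t, hη1]
        · rw [indicator_of_notMem ht, setLIntegral_eq_zero measurableSet_ball, zero_mul]
          intro z hz
          have h0 : η (z - t) = 0 := by
            rw [← Function.notMem_support, φ.support_normed_eq, mem_ball, dist_zero_right,
              ← dist_eq_norm]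
            rw [mem_closedBall] at ht
            rw [mem_ball] at hz
            linarith [dist_triangle_left t x z]
          simp [h0]
    _ = _ := lintegral_indicator measurableSet_closedBall _

theorem IsWeakGradient.exists_approximation {d : ℕ} {f : E d → ℝ} {g : E d → E d}
    (hf : Integrable f) (hg : StronglyMeasurable g) (hfg : IsWeakGradient f g) :
    ∃ u : ℕ → E d → ℝ, (∀ k, ContDiff ℝ 1 (u k)) ∧
      (∀ᵐ a, Tendsto (fun k => u k a) atTop (𝓝 (f a))) ∧
      ∀ (x : E d) (r : ℝ), 0 < r → ∀ᶠ k in atTop,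
        ∫⁻ z in ball x r, ‖fderiv ℝ (u k) z‖ₑ ≤ ∫⁻ z in closedBall x (2 * r), ‖g z‖ₑ := by
  -- The fixed ratio of outer to inner radius is what almost everywhere convergence of the
  -- mollifications requires.
  let φ : ℕ → ContDiffBump (0 : E d) := fun k =>
    ⟨1 / ((k : ℝ) + 1) / 2, 1 / ((k : ℝ) + 1), by positivity, half_lt_self (by positivity)⟩
  have hφ0 : Tendsto (fun k => (φ k).rOut) atTop (𝓝 0) := tendsto_one_div_add_atTop_nhds_zero_nat
  have hφ1 : ∀ k, (φ k).rOut ≤ 2 * (φ k).rIn := fun k => le_of_eq (by simp only [φ]; ring)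
  refine ⟨fun k => convolution ((φ k).normed volume) f (ContinuousLinearMap.lsmul ℝ ℝ) volume,
    fun k => ?_, ?_, fun x r hr => ?_⟩
  · exact (φ k).hasCompactSupport_normed.contDiff_convolution_left _ (n := 1)
      (φ k).contDiff_normed hf.locallyIntegrable
  · exact ContDiffBump.ae_convolution_tendsto_right_of_locallyIntegrable hφ0
      (Eventually.of_forall hφ1) hf.locallyIntegrable
  · filter_upwards [hφ0.eventually_lt_const hr] with k hk
    exact setLIntegral_enorm_fderiv_convolution_le hf hg hfg (φ k) x hk.le

/-- A two-point form of Poincaré's inequality for Sobolev functions. -/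
theorem IsWeakGradient.setLIntegral_setLIntegral_enorm_sub_le {d : ℕ} {f : E d → ℝ}
    {g : E d → E d} (hf : Integrable f) (hg : StronglyMeasurable g) (hfg : IsWeakGradient f g)
    (x : E d) {r : ℝ} (hr : 0 < r) :
    ∫⁻ a in ball x r, ∫⁻ b in ball x r, ‖f a - f b‖ₑ ≤
      ENNReal.ofReal (2 * r) * (ENNReal.ofReal (2 ^ d) *
        (∫⁻ z in closedBall x (2 * r), ‖g z‖ₑ) * volume (ball x r)) := by
  obtain ⟨u, hu, hlim, hgrad⟩ := hfg.exists_approximation hf hg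
  have hum : ∀ k, Measurable fun p : E d × E d => ‖u k p.1 - u k p.2‖ₑ := fun k =>
    (((hu k).continuous.comp continuous_fst).sub
      ((hu k).continuous.comp continuous_snd)).measurable.enorm
  -- Fatou's lemma, applied in each variable in turn, makes almost everywhere convergence
  -- sufficient.
  have hfatou : ∀ a, Tendsto (fun k => u k a) atTop (𝓝 (f a)) →
      ∫⁻ b in ball x r, ‖f a - f b‖ₑ ≤
        liminf (fun k => ∫⁻ b in ball x r, ‖u k a - u k b‖ₑ) atTop := fun a ha => by
    have hmeas : ∀ k, Measurable fun b => ‖u k a - u k b‖ₑ := fun k =>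
      (hum k).comp measurable_prodMk_left
    refine le_trans (le_of_eq ?_) (lintegral_liminf_le hmeas)
    refine lintegral_congr_ae (ae_restrict_of_ae ?_)
    filter_upwards [hlim] with b hb
    exact (Tendsto.liminf_eq (ha.sub hb).enorm).symm
  calc ∫⁻ a in ball x r, ∫⁻ b in ball x r, ‖f a - f b‖ₑ
      ≤ ∫⁻ a in ball x r, liminf (fun k => ∫⁻ b in ball x r, ‖u k a - u k b‖ₑ) atTop := by
        refine lintegral_mono_ae (ae_restrict_of_ae ?_)
        filter_upwards [hlim] with a ha using hfatou a ha
    _ ≤ liminf (fun k => ∫⁻ a in ball x r, ∫⁻ b in ball x r, ‖u k a - u k b‖ₑ) atTop :=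
        lintegral_liminf_le fun k => (hum k).lintegral_prod_right'
    _ ≤ _ := by
        refine liminf_le_of_frequently_le' (Eventually.frequently ?_)
        filter_upwards [hgrad x r hr] with k hk
        refine (BVSobolev.setLIntegral_setLIntegral_enorm_sub_le (hu k) x r).trans ?_
        gcongr

/-- The maximal function of a Sobolev function is controlled by averages of its gradient. -/
theorem IsWeakGradient.oscillation_le {d : ℕ} {f : E d → ℝ}
    {g : E d → E d} (hf : Integrable f) (hg : StronglyMeasurable g) (hfg : IsWeakGradient f g)
    (x : E d) {r : ℝ} (hr : 0 < r) :
    (ENNReal.ofReal r)⁻¹ * ⨍⁻ y in ball x r, ‖f y - ⨍ z in ball x r, f z ∂volume‖ₑ ∂volume ≤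
      ENNReal.ofReal (2 * 2 ^ d) *
        ((∫⁻ z in closedBall x (2 * r), ‖g z‖ₑ) / volume (ball x r)) := by
  set V := volume (ball x r) with hV
  have hV0 : V ≠ 0 := (measure_ball_pos _ _ hr).ne'
  have hVt : V ≠ ⊤ := measure_ball_lt_top.ne
  have hr0 : ENNReal.ofReal r ≠ 0 := by simpa using hr
  have hpt : ∀ a, ‖f a - ⨍ z in ball x r, f z ∂volume‖ₑ ≤
      V⁻¹ * ∫⁻ b in ball x r, ‖f a - f b‖ₑ := fun a => by
    have hVr : volume.real (ball x r) ≠ 0 := ENNReal.toReal_ne_zero.2 ⟨hV0, hVt⟩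
    have hfB : Integrable f (volume.restrict (ball x r)) := hf.integrableOn
    have hcB : Integrable (fun _ => f a) (volume.restrict (ball x r)) := integrableOn_const hVt
    have h1 : f a - ⨍ z in ball x r, f z ∂volume =
        (volume.real (ball x r))⁻¹ • ∫ b in ball x r, (f a - f b) := by
      rw [setAverage_eq, integral_sub hcB hfB,
        setIntegral_const, smul_sub, smul_smul, inv_mul_cancel₀ hVr, one_smul]
    rw [h1, enorm_smul, enorm_inv hVr]
    gcongr
    · rw [Real.enorm_of_nonneg measureReal_nonneg, ofReal_measureReal]
    · exact enorm_integral_le_lintegral_enorm _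
  rw [setLAverage_eq]
  calc (ENNReal.ofReal r)⁻¹ * ((∫⁻ y in ball x r, ‖f y - ⨍ z in ball x r, f z ∂volume‖ₑ) / V)
      ≤ (ENNReal.ofReal r)⁻¹ *
          ((∫⁻ a in ball x r, V⁻¹ * ∫⁻ b in ball x r, ‖f a - f b‖ₑ) / V) := by
        gcongr with a
        exact hpt a
    _ ≤ (ENNReal.ofReal r)⁻¹ * ((V⁻¹ * (ENNReal.ofReal (2 * r) * (ENNReal.ofReal (2 ^ d) *
        (∫⁻ z in closedBall x (2 * r), ‖g z‖ₑ) * V))) / V) := by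
        rw [lintegral_const_mul' _ _ (ENNReal.inv_ne_top.2 hV0)]
        gcongr
        exact hfg.setLIntegral_setLIntegral_enorm_sub_le hf hg x hr
    _ = ((ENNReal.ofReal r)⁻¹ * ENNReal.ofReal r) * (V⁻¹ * V) * (ENNReal.ofReal (2 * 2 ^ d) *
        ((∫⁻ z in closedBall x (2 * r), ‖g z‖ₑ) / V)) := by
        rw [ENNReal.ofReal_mul (by norm_num), ENNReal.ofReal_mul (by norm_num), div_eq_mul_inv,
          div_eq_mul_inv]
        ring
    _ = _ := by
        rw [ENNReal.inv_mul_cancel hr0 ENNReal.ofReal_ne_top, ENNReal.inv_mul_cancel hV0 hVt,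
          one_mul, one_mul]

/-! ### Weak-type estimate for Sobolev functions. -/

theorem tendsto_lintegral_indicator_lt {α : Type*} [MeasurableSpace α] {μ : Measure α}
    {h : α → ℝ≥0∞} (hm : Measurable h) (hfin : ∫⁻ x, h x ∂μ ≠ ⊤) :
    Tendsto (fun τ : ℝ => ∫⁻ x, {x | ENNReal.ofReal τ < h x}.indicator h x ∂μ) atTop (𝓝 0) := by
  rw [← lintegral_zero (μ := μ)]
  refine tendsto_lintegral_filter_of_dominated_convergence h
    (Eventually.of_forall fun τ => hm.indicator (measurableSet_lt measurable_const hm))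
    (Eventually.of_forall fun τ => Eventually.of_forall fun x => indicator_le_self _ _ x) hfin ?_
  filter_upwards [ae_lt_top hm hfin] with x hx
  refine tendsto_const_nhds.congr' ?_
  filter_upwards [eventually_ge_atTop (h x).toReal] with τ hτ
  rw [indicator_of_notMem]
  simpa using (ENNReal.le_ofReal_iff_toReal_le hx.ne (ENNReal.toReal_nonneg.trans hτ)).2 hτ

/-- The weak-type estimate for a Sobolev function, in terms of the large values of its gradient. -/
theorem IsWeakGradient.volume_maxA_le {d : ℕ} (hd : 1 ≤ d) {f : E d → ℝ} {g : E d → E d}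
    (hf : Integrable f) (hgi : Integrable g) (hg : StronglyMeasurable g)
    (hfg : IsWeakGradient f g) {τ : ℝ} (hτ : 0 < τ) :
    ENNReal.ofReal τ * volume {x | ENNReal.ofReal (2 * (2 * 2 ^ d * 2 ^ d) * τ) < maxA f x} ≤
      ENNReal.ofReal (5 ^ d) *
        ∫⁻ x, {x | ENNReal.ofReal τ < ‖g x‖ₑ}.indicator (fun x => ‖g x‖ₑ) x := by
  set k : E d → ℝ≥0∞ := {x | ENNReal.ofReal τ < ‖g x‖ₑ}.indicator (fun x => ‖g x‖ₑ) with hk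
  -- The factor 2·2^d comes from the oscillation bound, the last 2^d from passing from radius r to
  -- 2r. The extra 2 in the level 2Cτ leaves density τ for `k` after the part of |g| below τ is
  -- removed.
  set C : ℝ := 2 * 2 ^ d * 2 ^ d with hC
  have hC0 : 0 < C := by positivity
  set S := {x | ENNReal.ofReal (2 * C * τ) < maxA f x} with hS
  have hgm : Measurable fun x => ‖g x‖ₑ := hg.measurable.enorm
  have hkm : Measurable k := hgm.indicator (measurableSet_lt measurable_const hgm)
  have hkfin : ∫⁻ x, k x ≠ ⊤ :=
    ((lintegral_mono fun x => indicator_le_self _ _ x).trans_lt hgi.2).ne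
  have hgk : ∀ x, ‖g x‖ₑ ≤ ENNReal.ofReal τ + k x := fun x => by
    by_cases hx : ENNReal.ofReal τ < ‖g x‖ₑ
    · rw [hk, indicator_of_mem (show x ∈ {x | ENNReal.ofReal τ < ‖g x‖ₑ} from hx)]
      exact le_add_self
    · exact (not_lt.1 hx).trans le_self_add
  set ν := volume.withDensity k with hν
  have hτ0 : ENNReal.ofReal τ ≠ 0 := by simpa using hτ
  have hex : ∀ x ∈ S, ∃ r, 0 < r ∧
      ENNReal.ofReal τ * volume (closedBall x r) ≤ ν (closedBall x r) := by
    intro x hx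
    simp only [hS, mem_ofPred_eq, maxA, lt_iSup_iff] at hx
    obtain ⟨r, hr, hlt⟩ := hx
    refine ⟨2 * r, by positivity, ?_⟩
    set W := volume (closedBall x (2 * r)) with hW
    have hWt : W ≠ ⊤ := measure_closedBall_lt_top.ne
    have h1 := hlt.le.trans (hfg.oscillation_le hf hg x hr)
    have : Nonempty (Fin d) := ⟨⟨0, hd⟩⟩
    have hVW : W = ENNReal.ofReal (2 ^ d) * volume (ball x r) := by
      rw [hW, volume_closedBall_mul x zero_le_two hr.le,
        Measure.addHaar_closedBall_eq_addHaar_ball]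
    have hV0 : volume (ball x r) ≠ 0 := (measure_ball_pos _ _ hr).ne'
    rw [← mul_div_assoc, ENNReal.le_div_iff_mul_le (Or.inl hV0)
      (Or.inl measure_ball_lt_top.ne)] at h1
    have h2 : ∫⁻ z in closedBall x (2 * r), ‖g z‖ₑ ≤ ENNReal.ofReal τ * W + ν (closedBall x (2 * r)) := by
      rw [hν, withDensity_apply _ measurableSet_closedBall, hW, ← setLIntegral_const,
        ← lintegral_add_left measurable_const]
      exact lintegral_mono hgk
    have h3 : ENNReal.ofReal (2 * 2 ^ d) * (2 * (ENNReal.ofReal τ * W)) ≤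
        ENNReal.ofReal (2 * 2 ^ d) * (ENNReal.ofReal τ * W + ν (closedBall x (2 * r))) := by
      refine le_trans (le_of_eq ?_) (h1.trans (by gcongr))
      rw [hVW, hC, show 2 * (2 * 2 ^ d * 2 ^ d) * τ = (2 * 2 ^ d) * (2 * (τ * 2 ^ d)) by ring,
        ENNReal.ofReal_mul (p := 2 * 2 ^ d) (by positivity),
        ENNReal.ofReal_mul (p := 2) (q := τ * 2 ^ d) (by positivity),
        ENNReal.ofReal_mul (p := τ) (by positivity), ENNReal.ofReal_ofNat]
      ring
    rw [ENNReal.mul_le_mul_iff_right (by simp) ENNReal.ofReal_ne_top, two_mul] at h3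
    exact (ENNReal.add_le_add_iff_left (ENNReal.mul_ne_top ENNReal.ofReal_ne_top hWt)).1 h3
  choose! r hr0 hr1 using hex
  have hνfin : ν univ ≠ ⊤ := by rwa [hν, withDensity_apply _ MeasurableSet.univ, setLIntegral_univ]
  obtain ⟨R, hR⟩ := exists_forall_radius_le hd (c := ν univ / ENNReal.ofReal τ)
    (ENNReal.div_ne_top hνfin hτ0)
  -- Vitali's lemma with the roles reversed from the lower bound: here Lebesgue measure is estimated
  -- by the mass of the large gradient values.
  have hvit := measure_le_of_forall_closedBall_le (ENNReal.ofReal τ • volume) ν (S := S)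
    (T := univ) (r := r) (R := R) (K := ENNReal.ofReal (5 ^ d)) hr0 (fun x hx => hR x _ ?_)
    (fun x hx => ?_) (fun x _ => subset_univ _)
  · rwa [Measure.smul_apply, smul_eq_mul, hν, withDensity_apply _ MeasurableSet.univ,
      setLIntegral_univ] at hvit
  · rw [ENNReal.le_div_iff_mul_le (Or.inl hτ0) (Or.inl ENNReal.ofReal_ne_top), mul_comm]
    exact (hr1 x hx).trans (measure_mono (subset_univ _))
  · rw [Measure.smul_apply, smul_eq_mul, volume_closedBall_mul x (by norm_num) (hr0 x hx).le,
      mul_left_comm]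
    gcongr
    exact hr1 x hx

theorem MemW11.liminfA_eq_zero {d : ℕ} (hd : 1 ≤ d) {f : E d → ℝ} (h : MemW11 f) :
    liminfA f = 0 := by
  obtain ⟨hf, g₀, hg₀, hfg₀⟩ := h
  have hfi := memLp_one_iff_integrable.1 hf
  have hgi₀ := memLp_one_iff_integrable.1 hg₀
  set g := hgi₀.1.mk g₀
  have hgg : g₀ =ᵐ[volume] g := hgi₀.1.ae_eq_mk
  have hg : StronglyMeasurable g := hgi₀.1.stronglyMeasurable_mk
  have hgi : Integrable g := hgi₀.congr hgg
  have hfg : IsWeakGradient f g := fun φ hφ hc => by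
    rw [← hfg₀ φ hφ hc]
    refine integral_congr_ae ?_
    filter_upwards [hgg] with x hx
    rw [hx]
  set C : ℝ := 2 * (2 * 2 ^ d * 2 ^ d) with hC
  have hC0 : 0 < C := by positivity
  have h0 : Tendsto (fun t : ℝ => ENNReal.ofReal C * (ENNReal.ofReal (5 ^ d) *
      ∫⁻ x, {x | ENNReal.ofReal (t / C) < ‖g x‖ₑ}.indicator (fun x => ‖g x‖ₑ) x)) atTop (𝓝 0) := by
    have h1 := (tendsto_lintegral_indicator_lt (μ := volume) hg.measurable.enorm hgi.2.ne).comp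
      (tendsto_id.atTop_div_const hC0)
    have h2 := ENNReal.Tendsto.const_mul (a := ENNReal.ofReal C)
      (ENNReal.Tendsto.const_mul (a := ENNReal.ofReal (5 ^ d)) h1
      (Or.inr ENNReal.ofReal_ne_top)) (Or.inr ENNReal.ofReal_ne_top)
    simpa only [mul_zero, Function.comp_def, id] using h2
  refine Tendsto.liminf_eq (tendsto_of_tendsto_of_tendsto_of_le_of_le' tendsto_const_nhds h0
    (Eventually.of_forall fun _ => zero_le) ?_)
  filter_upwards [eventually_gt_atTop 0] with t ht
  have h3 := hfg.volume_maxA_le hd hfi hgi hg (τ := t / C) (by positivity)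
  rw [mul_div_cancel₀ t hC0.ne'] at h3
  refine le_trans (le_of_eq ?_) (mul_le_mul_right h3 (ENNReal.ofReal C))
  rw [← mul_assoc, ← ENNReal.ofReal_mul hC0.le, mul_div_cancel₀ t hC0.ne']

end BVSobolev

/-! ### The main theorem. -/

theorem mainTheorem1 (d : ℕ) (hd : 1 ≤ d) :
    (∃ C : ℝ≥0, 0 < C ∧
      ∀ f : BVSobolev.E d → ℝ, BVSobolev.MemBV f →
        ∀ Df : VectorMeasure (BVSobolev.E d) (BVSobolev.E d), BVSobolev.IsGradientMeasure f Df →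
          (C : ℝ≥0∞) * (BVSobolev.singularPart Df).variation univ ≤ BVSobolev.liminfA f) ∧
    (∀ f : BVSobolev.E d → ℝ, BVSobolev.MemBV f →
      (BVSobolev.MemW11 f ↔ BVSobolev.liminfA f = 0)) := by
  obtain ⟨C, hC, h⟩ := BVSobolev.variation_singularPart_le d hd
  refine ⟨⟨(Real.toNNReal C)⁻¹, by simpa using hC, fun f hf Df hDf => ?_⟩, fun f hf =>
    ⟨fun hW => hW.liminfA_eq_zero hd, fun h0 => ?_⟩⟩
  · have hC0 : Real.toNNReal C ≠ 0 := by simpa using hC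
    rw [ENNReal.coe_inv hC0, ← ENNReal.div_eq_inv_mul]
    exact ENNReal.div_le_of_le_mul' (h f Df (memLp_one_iff_integrable.1 hf.1) hDf)
  · obtain ⟨hfi, μ, hμ⟩ := hf
    refine BVSobolev.memW11_of_variation_singularPart_eq_zero hfi hμ ?_
    have := h f μ (memLp_one_iff_integrable.1 hfi) hμ
    rwa [h0, mul_zero, le_zero_iff] at this
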